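/- Let $k$ be a field that is a finitely generated field extension of a perfect field, that is, $k=F(s_1,\ldots,s_r)$ for some perfect field $F$ and some $s_1,\ldots,s_r\in k$. Let $\overline{k}$ be an algebraic closure of $k$, let $n\in\mathbb{N}$, and let $$ \sigma=\sum_{I\in\mathbb{N}^n}\alpha_I X^I\in\overline{k}[[x_1,\ldots,x_n]],\qquad \alpha_I\in\overline{k}, $$ be a formal power series, where $X^I=x_1^{i_1}\cdots x_n^{i_n}$ for $I=(i_1,\ldots,i_n)$. Let $L=k(\{\alpha_I\mid I\in\mathbb{N}^n\})\subseteq\overline{k}$ be the extension field of $k$ generated by the coefficients of $\sigma$, and let $k((x_1,\ldots,x_n))$ denote the quotient field of $k[[x_1,\ldots,x_n]]$. Then $\sigma$ is algebraic over $k((x_1,\ldots,x_n))$ if and only if $[L:k]<\infty$. -/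

import Mathlib

noncomputable section

namespace SeriesAlg

/-- A power series ring over a field is an integral domain. -/
instance instIsDomainSeries (n : ℕ) (k : Type*) [Field k] : IsDomain (MvPowerSeries (Fin n) k) :=
  NoZeroDivisors.to_isDomain _

/-- Extension of coefficients `k[[x₁,…,xₙ]] → K[[x₁,…,xₙ]]` is injective. -/
theorem map_injective (n : ℕ) (k K : Type*) [Field k] [Field K] [Algebra k K] :
    Function.Injective
      (MvPowerSeries.map (algebraMap k K) :
        MvPowerSeries (Fin n) k →+* MvPowerSeries (Fin n) K) := by
  rw [injective_iff_map_eq_zero]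
  intro f hf
  exact (MvPowerSeries.map_eq_zero f (algebraMap k K)).1 hf

/-- The field `k((x₁,…,xₙ))`, the quotient field of `k[[x₁,…,xₙ]]`. -/
abbrev SeriesField (n : ℕ) (k : Type*) [Field k] : Type _ :=
  FractionRing (MvPowerSeries (Fin n) k)

/-- The natural embedding `k((x₁,…,xₙ)) → K((x₁,…,xₙ))` induced by extension of coefficients. -/
def seriesFieldMap (n : ℕ) (k K : Type*) [Field k] [Field K] [Algebra k K] :
    SeriesField n k →+* SeriesField n K :=
  IsFractionRing.map (map_injective n k K)

/-- `σ ∈ K[[x₁,…,xₙ]]` is algebraic over the field `k((x₁,…,xₙ))`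
(both lying in the field `K((x₁,…,xₙ))`). -/
def IsAlgebraicSeries (k : Type*) {K : Type*} [Field k] [Field K] [Algebra k K] {n : ℕ}
    (σ : MvPowerSeries (Fin n) K) : Prop :=
  letI : Algebra (SeriesField n k) (SeriesField n K) := (seriesFieldMap n k K).toAlgebra
  IsAlgebraic (SeriesField n k)
    (algebraMap (MvPowerSeries (Fin n) K) (SeriesField n K) σ)

/-- The coefficient field `L = k({α_I})`: the subextension of `K / k` generated by all the
coefficients of `σ = ∑ α_I X^I`. -/
def coeffField (k : Type*) {K : Type*} [Field k] [Field K] [Algebra k K] {n : ℕ}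
    (σ : MvPowerSeries (Fin n) K) : IntermediateField k K :=
  IntermediateField.adjoin k (Set.range fun I : Fin n →₀ ℕ => MvPowerSeries.coeff I σ)

end SeriesAlg

end

/-! If `[L:k]` is finite, expanding the coefficients in a `k`-basis of `L` writes `σ` as a finite
sum of constants integral over `k` times series over `k`. Conversely, let `p` be the exponential
characteristic. Some `τ = σ ^ p ^ e` is a simple root of a polynomial `f` over `k[[x]]`. If `M` is
the lowest monomial of `f'(τ)`, Taylor expansion makes each coefficient of `τ` beyond `M` rational
in the earlier ones (`coeff_root_mem_range`), so all of them lie in `k(B)` with `B` finite. Among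
them are the `α_I ^ p ^ e`, and as `k` is finitely generated over a perfect field, all `p ^ e`-th
roots of elements of `k(B)` lie in one finite extension of `k`. -/

theorem MvPowerSeries.coeff_add_mul_of_forall_lt {ι R : Type*} [CommSemiring R] (m : MonomialOrder ι)
    {u v : MvPowerSeries ι R} {a b : ι →₀ ℕ}
    (hu : ∀ d, m.toSyn d < m.toSyn a → u.coeff d = 0)
    (hv : ∀ d, m.toSyn d < m.toSyn b → v.coeff d = 0) :
    (u * v).coeff (a + b) = u.coeff a * v.coeff b := by
  classical
  rw [MvPowerSeries.coeff_mul, Finset.sum_eq_single (a, b)]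
  · rintro ⟨p, q⟩ hpq hne
    rw [Finset.HasAntidiagonal.mem_antidiagonal] at hpq
    rcases lt_trichotomy (m.toSyn p) (m.toSyn a) with h | h | h
    · simp [hu p h]
    · obtain rfl := m.toSyn.injective h
      obtain rfl := add_left_cancel hpq
      exact absurd rfl hne
    · have hq : m.toSyn q < m.toSyn b := by
        have : m.toSyn p + m.toSyn q = m.toSyn a + m.toSyn b := by
          rw [← map_add, ← map_add]; exact congrArg _ hpq
        by_contra! hb
        exact (add_lt_add_of_lt_of_le h hb).ne' this
      simp [hv q hq]
  · simp

theorem MvPowerSeries.coeff_mul_of_lt_add {ι R : Type*} [CommSemiring R] (m : MonomialOrder ι)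
    {u v : MvPowerSeries ι R} {a b d : ι →₀ ℕ}
    (hu : ∀ d, m.toSyn d < m.toSyn a → u.coeff d = 0)
    (hv : ∀ d, m.toSyn d < m.toSyn b → v.coeff d = 0)
    (hd : m.toSyn d < m.toSyn a + m.toSyn b) :
    (u * v).coeff d = 0 := by
  classical
  rw [MvPowerSeries.coeff_mul]
  refine Finset.sum_eq_zero ?_
  rintro ⟨p, q⟩ hpq
  rw [Finset.HasAntidiagonal.mem_antidiagonal] at hpq
  by_cases hp : m.toSyn p < m.toSyn a
  · simp [hu p hp]
  · have hq : m.toSyn q < m.toSyn b := by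
      by_contra! hb
      have : m.toSyn p + m.toSyn q = m.toSyn d := by rw [← map_add]; exact congrArg _ hpq
      exact absurd (add_le_add (not_lt.1 hp) hb) (by rw [this]; exact not_le.2 hd)
    simp [hv q hq]

/-- The multivariate Newton step: beyond the lowest monomial of `f'(τ)`, every coefficient of a
root `τ` of `f` is determined rationally by the preceding ones. -/
theorem MvPowerSeries.coeff_root_mem_range {ι S K : Type*} [Field S] [Field K] [Algebra S K]
    (m : MonomialOrder ι) (f : Polynomial (MvPowerSeries ι S)) (τ : MvPowerSeries ι K)
    (hf : f.eval₂ (MvPowerSeries.map (algebraMap S K)) τ = 0) {M J : ι →₀ ℕ}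
    (hM : (f.derivative.eval₂ (MvPowerSeries.map (algebraMap S K)) τ).coeff M ≠ 0)
    (hlt : ∀ d, m.toSyn d < m.toSyn M →
      (f.derivative.eval₂ (MvPowerSeries.map (algebraMap S K)) τ).coeff d = 0)
    (hMJ : m.toSyn M < m.toSyn J)
    (hτ : ∀ d, m.toSyn d < m.toSyn J → τ.coeff d ∈ (algebraMap S K).range) :
    τ.coeff J ∈ (algebraMap S K).range := by
  classical
  choose! c hc using hτ
  let φ := MvPowerSeries.map (σ := ι) (algebraMap S K)
  -- The truncation of `τ` below `J`, descended to `S`; the remainder `s` starts at `J`.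
  let a₀ : MvPowerSeries ι S := fun d => if m.toSyn d < m.toSyn J then c d else 0
  have ha₀ (d) : a₀.coeff d = if m.toSyn d < m.toSyn J then c d else 0 := rfl
  let s := τ - φ a₀
  have hs (d) : s.coeff d = if m.toSyn d < m.toSyn J then 0 else τ.coeff d := by
    simp only [s, φ, map_sub, MvPowerSeries.coeff_map, ha₀]
    split_ifs with h
    · rw [hc d h, sub_self]
    · simp
  have hs0 (d) (h : m.toSyn d < m.toSyn J) : s.coeff d = 0 := by rw [hs, if_pos h]
  have hsJ : s.coeff J = τ.coeff J := by rw [hs, if_neg (lt_irrefl _)]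
  -- Vacuous, since `0` is the least monomial; it lets an arbitrary cofactor enter the order
  -- estimates.
  have hz : ∀ (u : MvPowerSeries ι K) d, m.toSyn d < m.toSyn (0 : ι →₀ ℕ) → u.coeff d = 0 := by
    intro u d hd
    rw [map_zero] at hd
    exact absurd hd (not_lt.2 (m.zero_le _))
  set g := f.map φ with hg
  have hev : ∀ p : Polynomial (MvPowerSeries ι S), (p.map φ).eval (φ a₀) = φ (p.eval a₀) := by
    intro p; rw [Polynomial.eval_map, Polynomial.eval₂_at_apply]
  have hroot : g.eval τ = 0 := by rw [hg, Polynomial.eval_map]; exact hf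
  have hder : g.derivative.eval τ = f.derivative.eval₂ φ τ := by
    rw [hg, Polynomial.derivative_map, Polynomial.eval_map]
  have hgd (d) (hd : m.toSyn d < m.toSyn J) :
      (g.derivative.eval (φ a₀)).coeff d = (f.derivative.eval₂ φ τ).coeff d := by
    obtain ⟨w, hw⟩ := Polynomial.sub_dvd_eval_sub τ (φ a₀) g.derivative
    rw [← hder, eq_comm, ← sub_eq_zero, ← map_sub, hw]
    exact MvPowerSeries.coeff_mul_of_lt_add m hs0 (hz w) (by simpa using hd)
  obtain ⟨w, hw⟩ := g.binomExpansion (φ a₀) s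
  have hτs : φ a₀ + s = τ := by simp [s]
  rw [hτs, hroot] at hw
  have key := congrArg (MvPowerSeries.coeff (M + J)) hw
  -- The quadratic term starts no lower than `J + J`, which exceeds `M + J`.
  have h2 : (w * s ^ 2).coeff (M + J) = 0 := by
    rw [mul_comm, sq]
    refine MvPowerSeries.coeff_mul_of_lt_add m (a := J + J) (b := 0) (fun d hd => ?_) (hz w) ?_
    · exact MvPowerSeries.coeff_mul_of_lt_add m hs0 hs0 (by simpa using hd)
    · simpa using hMJ
  have h1 : (g.derivative.eval (φ a₀) * s).coeff (M + J) =
      (g.derivative.eval (φ a₀)).coeff M * τ.coeff J := by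
    rw [MvPowerSeries.coeff_add_mul_of_forall_lt m (fun d hd => ?_) hs0, hsJ]
    rw [hgd d (hd.trans hMJ)]
    exact hlt d hd
  rw [map_zero, map_add, map_add, h1, h2, add_zero] at key
  have hM' : (g.derivative.eval (φ a₀)).coeff M ≠ 0 := by rw [hgd M hMJ]; exact hM
  rw [hg, Polynomial.derivative_map, hev, hev, MvPowerSeries.coeff_map,
    MvPowerSeries.coeff_map] at key
  rw [hg, Polynomial.derivative_map, hev, MvPowerSeries.coeff_map] at hM'
  refine ⟨-((f.eval a₀).coeff (M + J)) / (f.derivative.eval a₀).coeff M, ?_⟩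
  rw [map_div₀, map_neg, div_eq_iff hM']
  linear_combination key

/-- The coefficients of a simple root of a polynomial over `k[[x₁,…,xₙ]]` lie in a finitely
generated extension of `k`. -/
theorem MvPowerSeries.exists_finite_coeff_mem_adjoin {n : ℕ} {k K : Type*} [Field k] [Field K]
    [Algebra k K] (f : Polynomial (MvPowerSeries (Fin n) k)) (τ : MvPowerSeries (Fin n) K)
    (hf : f.eval₂ (MvPowerSeries.map (algebraMap k K)) τ = 0)
    (hf' : f.derivative.eval₂ (MvPowerSeries.map (algebraMap k K)) τ ≠ 0) :
    ∃ B : Set K, B.Finite ∧ ∀ d, τ.coeff d ∈ IntermediateField.adjoin k B := by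
  classical
  -- A graded order leaves only finitely many monomials up to `M`.
  let m : MonomialOrder (Fin n) := MonomialOrder.degLex
  set g := f.derivative.eval₂ (MvPowerSeries.map (algebraMap k K)) τ with hg
  have hne : {x : m.syn | g.coeff (m.toSyn.symm x) ≠ 0}.Nonempty := by
    obtain ⟨d, hd⟩ := (MvPowerSeries.ne_zero_iff_exists_coeff_ne_zero g).1 hf'
    exact ⟨m.toSyn d, by simpa using hd⟩
  let M := m.toSyn.symm (wellFounded_lt.min _ hne)
  have hM : g.coeff M ≠ 0 := wellFounded_lt.min_mem _ hne
  have hlt (d) (hd : m.toSyn d < m.toSyn M) : g.coeff d = 0 := by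
    by_contra h
    refine wellFounded_lt.not_lt_min {x : m.syn | g.coeff (m.toSyn.symm x) ≠ 0}
      (x := m.toSyn d) (by simpa using h) (by simpa [M] using hd)
  have hfin : {d : Fin n →₀ ℕ | d.degree ≤ M.degree}.Finite :=
    Finsupp.finite_of_degree_le M.degree
  refine ⟨(fun d => τ.coeff d) '' {d | d.degree ≤ M.degree}, hfin.image _, ?_⟩
  set S := IntermediateField.adjoin k ((fun d => τ.coeff d) '' {d | d.degree ≤ M.degree}) with hS
  have hcomp : (MvPowerSeries.map (σ := Fin n) (algebraMap S K)).comp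
      (MvPowerSeries.map (algebraMap k S)) = MvPowerSeries.map (algebraMap k K) := by
    rw [← MvPowerSeries.map_comp, ← IsScalarTower.algebraMap_eq]
  have hrange (x : K) : x ∈ (algebraMap S K).range ↔ x ∈ S :=
    ⟨fun ⟨y, hy⟩ => hy ▸ y.2, fun h => ⟨⟨x, h⟩, rfl⟩⟩
  have main : ∀ x : m.syn, τ.coeff (m.toSyn.symm x) ∈ S := by
    intro x
    induction x using WellFoundedLT.induction with
    | ind x ih =>
      obtain ⟨J, rfl⟩ := m.toSyn.surjective x
      rw [AddEquiv.symm_apply_apply]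
      by_cases hJ : m.toSyn M < m.toSyn J
      · rw [← hrange]
        refine MvPowerSeries.coeff_root_mem_range m (f.map (MvPowerSeries.map (algebraMap k S))) τ
          ?_ (M := M) ?_ ?_ hJ ?_
        · rw [Polynomial.eval₂_map, hcomp, hf]
        · rw [Polynomial.derivative_map, Polynomial.eval₂_map, hcomp]; exact hM
        · rw [Polynomial.derivative_map, Polynomial.eval₂_map, hcomp]; exact hlt
        · intro d hd
          rw [hrange]
          simpa using ih _ hd
      · refine IntermediateField.subset_adjoin _ _ ⟨J, ?_, rfl⟩
        exact Finsupp.DegLex.monotone_degree (not_lt.1 hJ)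
  intro d
  simpa using main (m.toSyn d)

/-- If `k` is finitely generated over a perfect field, then the `p^e`-th roots of the elements of
a finitely generated algebraic extension of `k` lie in a finite extension of `k`. -/
theorem IntermediateField.exists_finiteDimensional_of_pow_mem_adjoin (F k K : Type*) [Field F]
    [PerfectField F] [Field k] [Algebra F k] (hk : (⊤ : IntermediateField F k).FG)
    [Field K] [Algebra k K] [IsAlgClosure k K] (p e : ℕ) [ExpChar K p] {B : Set K}
    (hB : B.Finite) :
    ∃ E : IntermediateField k K, FiniteDimensional k E ∧
      ∀ y : K, y ^ p ^ e ∈ IntermediateField.adjoin k B → y ∈ E := by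
  have : IsAlgClosed K := IsAlgClosure.isAlgClosed k
  have : Algebra.IsAlgebraic k K := IsAlgClosure.isAlgebraic
  have : ExpChar k p := RingHom.expChar _ (algebraMap k K).injective p
  have : ExpChar F p := RingHom.expChar _ (algebraMap F k).injective p
  obtain ⟨A, hA⟩ := hk
  have hroot (x : K) : ∃ z, z ^ p ^ e = x :=
    IsAlgClosed.exists_pow_nat_eq x (pow_pos (expChar_pos K p) e)
  choose r hr using hroot
  let T : Set K := r '' (algebraMap k K '' A ∪ B)
  have hT : T.Finite := ((A.finite_toSet.image _).union hB).image _
  have hfd : FiniteDimensional k (IntermediateField.adjoin k T) :=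
    have := hT.to_subtype
    IntermediateField.finiteDimensional_adjoin fun x _ => Algebra.IsIntegral.isIntegral x
  refine ⟨IntermediateField.adjoin k T, hfd, ?_⟩
  set E := IntermediateField.adjoin k T with hE
  -- The `p ^ e`-th powers of `E` form a subfield, so only generators need checking; perfectness
  -- puts `F` inside it.
  let Q : Subfield K := E.toSubfield.map (iterateFrobenius K p e)
  have hQ (x : K) : x ∈ Q ↔ ∃ z ∈ E, z ^ p ^ e = x := Iff.rfl
  have hQT (x : K) (hx : x ∈ algebraMap k K '' A ∪ B) : x ∈ Q :=
    (hQ x).2 ⟨r x, IntermediateField.subset_adjoin _ _ ⟨x, hx, rfl⟩, hr x⟩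
  have hkQ (x : k) : algebraMap k K x ∈ Q := by
    have hx : x ∈ IntermediateField.adjoin F (A : Set k) := by rw [hA]; trivial
    induction hx using IntermediateField.adjoin_induction with
    | mem x hx => exact hQT _ (Or.inl ⟨x, hx, rfl⟩)
    | algebraMap x =>
      obtain ⟨y, rfl⟩ := (bijective_iterateFrobenius F p e).2 x
      rw [hQ]
      refine ⟨algebraMap k K (algebraMap F k y), E.algebraMap_mem _, ?_⟩
      rw [iterateFrobenius_def, map_pow, map_pow]
    | add x y _ _ hx hy => rw [map_add]; exact add_mem hx hy
    | inv x _ hx => rw [map_inv₀]; exact inv_mem hx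
    | mul x y _ _ hx hy => rw [map_mul]; exact mul_mem hx hy
  intro y hy
  have hyQ : y ^ p ^ e ∈ Q := by
    generalize y ^ p ^ e = x at hy
    induction hy using IntermediateField.adjoin_induction with
    | mem x hx => exact hQT _ (Or.inr hx)
    | algebraMap x => exact hkQ x
    | add x y _ _ hx hy => exact add_mem hx hy
    | inv x _ hx => exact inv_mem hx
    | mul x y _ _ hx hy => exact mul_mem hx hy
  obtain ⟨z, hz, hzy⟩ := (hQ _).1 hyQ
  have : z = y := iterateFrobenius_inj K p e hzy
  exact this ▸ hz

namespace SeriesAlg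

theorem seriesFieldMap_algebraMap (n : ℕ) (k K : Type*) [Field k] [Field K] [Algebra k K]
    (f : MvPowerSeries (Fin n) k) :
    seriesFieldMap n k K (algebraMap _ _ f) =
      algebraMap _ (SeriesField n K) (MvPowerSeries.map (algebraMap k K) f) := by
  unfold seriesFieldMap IsFractionRing.map
  exact IsLocalization.map_eq _ f

theorem seriesFieldMap_isIntegralElem_C (n : ℕ) {k K : Type*} [Field k] [Field K] [Algebra k K]
    {x : K} (hx : IsIntegral k x) :
    (seriesFieldMap n k K).IsIntegralElem
      (algebraMap (MvPowerSeries (Fin n) K) (SeriesField n K) (MvPowerSeries.C x)) := by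
  obtain ⟨q, hq, hqx⟩ := hx
  let ι : k →+* SeriesField n k := (algebraMap (MvPowerSeries (Fin n) k) _).comp MvPowerSeries.C
  let κ : K →+* SeriesField n K := (algebraMap (MvPowerSeries (Fin n) K) _).comp MvPowerSeries.C
  have hcomp : (seriesFieldMap n k K).comp ι = κ.comp (algebraMap k K) := by
    ext y
    simp only [ι, κ, RingHom.comp_apply]
    rw [seriesFieldMap_algebraMap, MvPowerSeries.map_C]
  refine ⟨q.map ι, hq.map ι, ?_⟩
  rw [Polynomial.eval₂_map, hcomp, ← RingHom.comp_apply, ← Polynomial.hom_eval₂, hqx, map_zero]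

/-- Some `p^e`-th power of an algebraic series is a simple root of a polynomial over
`k[[x₁,…,xₙ]]`. -/
theorem IsAlgebraicSeries.exists_pow_simple_root {k K : Type*} [Field k] [Field K] [Algebra k K]
    {n : ℕ} {σ : MvPowerSeries (Fin n) K} (h : IsAlgebraicSeries k σ) (p : ℕ) [ExpChar k p] :
    ∃ (e : ℕ) (f : Polynomial (MvPowerSeries (Fin n) k)),
      f.eval₂ (MvPowerSeries.map (algebraMap k K)) (σ ^ p ^ e) = 0 ∧
      f.derivative.eval₂ (MvPowerSeries.map (algebraMap k K)) (σ ^ p ^ e) ≠ 0 := by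
  let : Algebra (SeriesField n k) (SeriesField n K) := (seriesFieldMap n k K).toAlgebra
  have : ExpChar (MvPowerSeries (Fin n) k) p :=
    expChar_of_injective_ringHom (f := MvPowerSeries.C) (MvPowerSeries.C_injective) p
  have : ExpChar (SeriesField n k) p :=
    expChar_of_injective_algebraMap (IsFractionRing.injective (MvPowerSeries (Fin n) k) _) p
  let s := algebraMap (MvPowerSeries (Fin n) K) (SeriesField n K) σ
  have hs : IsAlgebraic (SeriesField n k) s := h
  obtain ⟨g, hg, e, hge⟩ := (minpoly.irreducible hs.isIntegral).hasSeparableContraction p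
  have hroot : Polynomial.aeval (s ^ p ^ e) g = 0 := by
    rw [← Polynomial.expand_aeval, hge, minpoly.aeval]
  have hder : Polynomial.aeval (s ^ p ^ e) g.derivative ≠ 0 := hg.aeval_derivative_ne_zero hroot
  obtain ⟨b, hb, hf⟩ := IsLocalization.integerNormalization_spec
    (nonZeroDivisors (MvPowerSeries (Fin n) k)) g
  set f := IsLocalization.integerNormalization (nonZeroDivisors (MvPowerSeries (Fin n) k)) g
  have hcomp : (algebraMap (MvPowerSeries (Fin n) K) (SeriesField n K)).comp
      (MvPowerSeries.map (algebraMap k K)) =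
      (algebraMap (SeriesField n k) (SeriesField n K)).comp (algebraMap _ _) :=
    RingHom.ext fun x => (seriesFieldMap_algebraMap n k K x).symm
  have hev (q : Polynomial (MvPowerSeries (Fin n) k)) :
      algebraMap _ (SeriesField n K) (q.eval₂ (MvPowerSeries.map (algebraMap k K)) (σ ^ p ^ e)) =
      Polynomial.aeval (s ^ p ^ e) (q.map (algebraMap _ (SeriesField n k))) := by
    rw [Polynomial.hom_eval₂, hcomp, Polynomial.aeval_def, Polynomial.eval₂_map, map_pow]
  have hb0 : algebraMap (MvPowerSeries (Fin n) k) (SeriesField n k) b ≠ 0 :=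
    IsFractionRing.to_map_ne_zero_of_mem_nonZeroDivisors hb
  refine ⟨e, f, ?_, fun h0 => ?_⟩
  · apply IsFractionRing.injective (MvPowerSeries (Fin n) K) (SeriesField n K)
    rw [hev, hf, map_zero, ← IsScalarTower.algebraMap_smul (SeriesField n k) b g, map_smul, hroot,
      smul_zero]
  · have h1 := hev f.derivative
    rw [h0, map_zero, ← Polynomial.derivative_map, hf,
      ← IsScalarTower.algebraMap_smul (SeriesField n k) b g, Polynomial.derivative_smul, map_smul,
      eq_comm, Algebra.smul_def, mul_eq_zero, map_eq_zero] at h1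
    exact h1.elim hb0 hder

theorem IsAlgebraicSeries.finiteDimensional_coeffField (F : Type*) {k K : Type*} [Field F]
    [PerfectField F] [Field k] [Algebra F k] (hk : (⊤ : IntermediateField F k).FG)
    [Field K] [Algebra k K] [IsAlgClosure k K]
    {n : ℕ} {σ : MvPowerSeries (Fin n) K} (h : IsAlgebraicSeries k σ) :
    FiniteDimensional k (coeffField k σ) := by
  obtain ⟨p, hp⟩ := ExpChar.exists K
  have : ExpChar k p := RingHom.expChar _ (algebraMap k K).injective p
  obtain ⟨e, f, hf, hf'⟩ := h.exists_pow_simple_root p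
  obtain ⟨B, hB, hmem⟩ := MvPowerSeries.exists_finite_coeff_mem_adjoin f _ hf hf'
  obtain ⟨E, hE, hroot⟩ :=
    IntermediateField.exists_finiteDimensional_of_pow_mem_adjoin F k K hk p e hB
  have hle : coeffField k σ ≤ E := by
    refine IntermediateField.adjoin_le_iff.2 ?_
    rintro _ ⟨I, rfl⟩
    apply hroot
    -- By Frobenius, `σ ^ p ^ e` has coefficient `α_I ^ p ^ e` at `p ^ e • I`.
    have := hmem (p ^ e • I)
    rwa [← MvPowerSeries.map_iterateFrobenius_expand p (expChar_ne_zero K p) σ e,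
      MvPowerSeries.coeff_map, MvPowerSeries.coeff_expand_smul, iterateFrobenius_def] at this
  exact Module.Finite.of_injective (IntermediateField.inclusion hle).toLinearMap
    (IntermediateField.inclusion hle).injective

theorem isAlgebraicSeries_of_finiteDimensional {k K : Type*} [Field k] [Field K] [Algebra k K]
    {n : ℕ} {σ : MvPowerSeries (Fin n) K} [FiniteDimensional k (coeffField k σ)] :
    IsAlgebraicSeries k σ := by
  let : Algebra (SeriesField n k) (SeriesField n K) := (seriesFieldMap n k K).toAlgebra
  let L := coeffField k σ
  let b := Module.finBasis k L
  let ψ : MvPowerSeries (Fin n) K →+* SeriesField n K := algebraMap _ _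
  let τ (i) : MvPowerSeries (Fin n) k := fun I =>
    b.repr ⟨σ.coeff I, IntermediateField.subset_adjoin _ _ ⟨I, rfl⟩⟩ i
  have hτ (i I) : (τ i).coeff I =
    b.repr ⟨σ.coeff I, IntermediateField.subset_adjoin _ _ ⟨I, rfl⟩⟩ i := rfl
  have hσ : σ = ∑ i, MvPowerSeries.C (b i : K) * MvPowerSeries.map (algebraMap k K) (τ i) := by
    ext I
    have := congrArg (algebraMap L K)
      (b.sum_repr ⟨σ.coeff I, IntermediateField.subset_adjoin _ _ ⟨I, rfl⟩⟩)
    rw [map_sum] at this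
    rw [map_sum, ← show _ = σ.coeff I from this]
    refine Finset.sum_congr rfl fun i _ => ?_
    rw [MvPowerSeries.coeff_C_mul, MvPowerSeries.coeff_map, hτ, Algebra.smul_def, map_mul,
      mul_comm]
    rfl
  suffices h : IsIntegral (SeriesField n k) (ψ σ) from h.isAlgebraic
  rw [hσ, map_sum]
  refine IsIntegral.sum _ fun i _ => ?_
  rw [map_mul]
  refine IsIntegral.mul ?_ ?_
  · exact seriesFieldMap_isIntegralElem_C n
      ((Algebra.IsIntegral.isIntegral (R := k) (b i)).map L.val)
  · have : ψ (MvPowerSeries.map (algebraMap k K) (τ i)) =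
        algebraMap (SeriesField n k) (SeriesField n K) (algebraMap _ _ (τ i)) :=
      (seriesFieldMap_algebraMap n k K (τ i)).symm
    rw [this]
    exact isIntegral_algebraMap

end SeriesAlg

theorem corollary3p3
    (F k K : Type*) [Field F] [PerfectField F] [Field k] [Algebra F k]
    (hk : (⊤ : IntermediateField F k).FG)
    [Field K] [Algebra k K] [IsAlgClosure k K]
    (n : ℕ) (σ : MvPowerSeries (Fin n) K) :
    SeriesAlg.IsAlgebraicSeries k σ ↔ FiniteDimensional k (SeriesAlg.coeffField k σ) :=
  ⟨fun h => h.finiteDimensional_coeffField F hk,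
    fun _ => SeriesAlg.isAlgebraicSeries_of_finiteDimensional⟩
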